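/- Let $a_2, a_3$ be integers with $1 < a_2 < a_3$ and let $A = \{1, a_2, a_3\}$. For integers $h, x \ge 0$, say that $x$ has an $h$-representation if $x = c_3 a_3 + c_2 a_2 + c_1$ for some integers $c_1, c_2, c_3 \ge 0$ with $c_1 + c_2 + c_3 \le h$. Let $X(h)$ be one less than the smallest positive integer that has no $h$-representation, and call the basis $B(A,h)$ admissible if $X(h) \ge a_3$. Let $h_0$ be the smallest $h$ for which $B(A,h)$ is admissible, let $h_1$ be the smallest value such that $X(h+1) = X(h) + a_3$ for all $h \ge h_1$, and let $h_2$ be the smallest value with $h_2 \ge h_1$ such that for all $h \ge h_2$ and all integers $x$ with $X(h) < x < h a_3$: $x$ has no $h$-representation if and only if $x + a_3$ has no $(h+1)$-representation. **Theorem.** (i) If $B(A,h)$ is admissible, then for every integer $x$ with $X(h) < x < h a_3$, $x$ has no $h$-representation if and only if $x + a_3$ has no $(h+1)$-representation. (ii) The values $h_0$, $h_1$ and $h_2$ exist, and $h_2 \le h_0$. -/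

import Mathlib

/-- `x` has an `h`-representation by `{1, a₂, a₃}`: it is a sum of at most `h` elements of that
set, repetitions allowed. -/
def HasRep (a₂ a₃ h x : ℕ) : Prop :=
  ∃ c₁ c₂ c₃ : ℕ, x = c₃ * a₃ + c₂ * a₂ + c₁ ∧ c₁ + c₂ + c₃ ≤ h

/-- The `h`-range `X(h)`: one less than the smallest integer with no `h`-representation.
(That integer exists, because `1 + h * max 1 a₂ a₃` has none, and it is positive, because `0` is the
empty sum.) -/
noncomputable def hRange (a₂ a₃ h : ℕ) : ℕ :=
  sInf {x : ℕ | ¬ HasRep a₂ a₃ h x} - 1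

/-- The basis `B({1, a₂, a₃}, h)` is admissible. -/
def Admissible (a₂ a₃ h : ℕ) : Prop :=
  a₃ ≤ hRange a₂ a₃ h

/-- Strictly between `X(h)` and `h * a₃`, the gaps at level `h` are exactly those at level `h + 1`
translated by `a₃`. -/
def GapsStable (a₂ a₃ h : ℕ) : Prop :=
  ∀ x : ℕ, hRange a₂ a₃ h < x → x < h * a₃ →
    (¬ HasRep a₂ a₃ h x ↔ ¬ HasRep a₂ a₃ (h + 1) (x + a₃))

/-- `h₀` is the smallest `h` for which the basis is admissible. -/
def IsH0 (a₂ a₃ h₀ : ℕ) : Prop :=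
  IsLeast {h : ℕ | Admissible a₂ a₃ h} h₀

/-- `h₁` is the smallest value with `X(h + 1) = X(h) + a₃` for all `h ≥ h₁`. -/
def IsH1 (a₂ a₃ h₁ : ℕ) : Prop :=
  IsLeast {k : ℕ | ∀ h : ℕ, k ≤ h → hRange a₂ a₃ (h + 1) = hRange a₂ a₃ h + a₃} h₁

/-- `h₂` is the smallest value, not below `h₁`, such that the gaps are stable for all `h ≥ h₂`. -/
def IsH2 (a₂ a₃ h₂ : ℕ) : Prop :=
  ∃ h₁ : ℕ, IsH1 a₂ a₃ h₁ ∧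
    IsLeast {k : ℕ | h₁ ≤ k ∧ ∀ h : ℕ, k ≤ h → GapsStable a₂ a₃ h} h₂

/-! The core fact: at an admissible level `h`, an `(h + 1)`-representation of `x + a₃` yields an
`h`-representation of `x`. If it uses `a₃`, drop one copy. If not, `exists_coinCost_le` trades it
for one that does, within the same number of summands; the level it requires is what
`Admissible.div_add_le` supplies. Hence all gaps shift by exactly `a₃` at admissible levels, and
these are closed upward, so `h₀` bounds both `h₁` and `h₂`. The trade is a pigeonhole argument on
the number `t` of summands `n`. -/

/-- Writing `z = p * k + r` with a nonnegative remainder never costs less than Euclidean division. -/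
theorem Int.ediv_add_emod_le {k z p r : ℤ} (hk : 1 ≤ k) (hr : 0 ≤ r) (hz : z = p * k + r) :
    z / k + z % k ≤ p + r := by
  have h1 := Int.mul_ediv_add_emod z k
  have h2 := Int.emod_lt_of_pos z (show 0 < k by omega)
  have h3 : p ≤ z / k := by
    rw [Int.le_ediv_iff_mul_le (by omega)]
    omega
  nlinarith

/-! ### Exchanging summands -/

/-- The least number of summands `1` and `k`, plus `t`, in a sum equal to `y` with exactly `t`
summands `n`. -/
def coinCost (k n y t : ℤ) : ℤ := t + (y - t * n) / k + (y - t * n) % k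

/-- Since `y - (t - t') * n = y + (y - t * n) - (y - t' * n)`, quotients and remainders combine the
same way; `h` keeps the combined remainder nonnegative. -/
theorem coinCost_sub_le {k n y t t' : ℤ} (hk : 1 ≤ k)
    (h : (y - t' * n) % k ≤ (y - t * n) % k) :
    coinCost k n y (t - t') ≤ coinCost k n y 0 + coinCost k n y t - coinCost k n y t' := by
  have h0 := Int.mul_ediv_add_emod (y - 0 * n) k
  have h1 := Int.mul_ediv_add_emod (y - t * n) k
  have h2 := Int.mul_ediv_add_emod (y - t' * n) k
  have h3 := Int.emod_nonneg (y - 0 * n) (show k ≠ 0 by omega)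
  have := Int.ediv_add_emod_le (k := k) (z := y - (t - t') * n)
    (p := (y - 0 * n) / k + (y - t * n) / k - (y - t' * n) / k)
    (r := (y - 0 * n) % k + (y - t * n) % k - (y - t' * n) % k) hk (by omega) (by linarith)
  unfold coinCost
  linarith

/-- With equal remainders the quotient drops by at least `t - t'` from `t'` to `t`, so `t` costs no
more than `t'`. -/
theorem coinCost_sub_le_of_emod_eq {k n y t t' : ℤ} (hk : 1 ≤ k) (hkn : k ≤ n) (htt : t' ≤ t)
    (h : (y - t * n) % k = (y - t' * n) % k) :
    coinCost k n y (t - t') ≤ coinCost k n y 0 := by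
  have h1 := Int.mul_ediv_add_emod (y - t * n) k
  have h2 := Int.mul_ediv_add_emod (y - t' * n) k
  have h3 := coinCost_sub_le (n := n) (y := y) hk h.ge
  have h4 : t - t' ≤ (y - t' * n) / k - (y - t * n) / k := by
    by_contra! hc
    nlinarith
  unfold coinCost at *
  linarith

/-- Equal costs and `n ≥ k > 1` force the remainder at `t'` to be at most that at `t`, so
`coinCost_sub_le` applies and the two costs cancel. -/
theorem coinCost_sub_le_of_eq {k n y t t' : ℤ} (hk : 1 < k) (hkn : k ≤ n) (htt : t' ≤ t)
    (h : coinCost k n y t = coinCost k n y t') :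
    coinCost k n y (t - t') ≤ coinCost k n y 0 := by
  have h1 := Int.mul_ediv_add_emod (y - t * n) k
  have h2 := Int.mul_ediv_add_emod (y - t' * n) k
  have h4 : t - t' ≤ (y - t' * n) / k - (y - t * n) / k := by
    unfold coinCost at h
    by_contra! hc
    nlinarith
  have h3 := coinCost_sub_le (k := k) (n := n) (y := y) (t := t) (t' := t') (by omega) (by
    unfold coinCost at h
    linarith)
  linarith

/-- If `y ≥ n` is a sum of at most `H` summands `1` and `k`, and `H ≥ n / k + k - 1`, then `y` is
also a sum of at most `H` summands `1`, `k`, `n` using `n` at least once. -/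
theorem exists_coinCost_le {k n y H : ℤ} (hk : 1 < k) (hkn : k ≤ n) (hy : n ≤ y)
    (hH : n / k + k - 1 ≤ H) (h0 : coinCost k n y 0 ≤ H) :
    ∃ t : ℤ, 1 ≤ t ∧ t * n ≤ y ∧ coinCost k n y t ≤ H := by
  by_contra! hc
  have hn := Int.mul_ediv_add_emod n k
  have hR0 := Int.emod_nonneg n (show k ≠ 0 by omega)
  have hRk := Int.emod_lt_of_pos n (show 0 < k by omega)
  have hQ : 1 ≤ n / k := by
    rw [Int.le_ediv_iff_mul_le (by omega)]
    omega
  set Q := n / k with hQdef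
  set R := n % k with hRdef
  -- `N` is the first count at which `y - N * n` drops below `Q * k`. It may be negative, but it
  -- stays at least `-R > -k`.
  obtain ⟨N, hN1, hN2⟩ : ∃ N : ℤ, Q * k ≤ y - (N - 1) * n ∧ y - N * n < Q * k := by
    have e1 := Int.mul_ediv_add_emod (y - Q * k) n
    have e2 := Int.emod_nonneg (y - Q * k) (show n ≠ 0 by omega)
    have e3 := Int.emod_lt_of_pos (y - Q * k) (show 0 < n by omega)
    exact ⟨(y - Q * k) / n + 1, by linarith, by linarith⟩
  have hNpos : 1 ≤ N := by
    by_contra! hlt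
    nlinarith
  have hQk : k ≤ Q * k := by nlinarith
  have hlt : ∀ t, 1 ≤ t → t < N → H < coinCost k n y t := fun t ht htN =>
    hc t ht (by nlinarith)
  have hqN : (y - N * n) / k ≤ Q - 1 := by
    have : (y - N * n) / k < Q := by
      rw [Int.ediv_lt_iff_lt_mul (by omega)]
      exact hN2
    omega
  have hmodN := Int.emod_lt_of_pos (y - N * n) (show 0 < k by omega)
  have hmodN0 := Int.emod_nonneg (y - N * n) (show k ≠ 0 by omega)
  have hCN : H < coinCost k n y N := by
    by_cases hyN : N * n ≤ y
    · exact hc N hNpos hyN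
    · push Not at hyN
      have hN2' : 2 ≤ N := by
        by_contra! h
        have : N = 1 := by omega
        subst this
        omega
      -- The bounds `h1` and `hp` add up to cost(1) + cost(N - 1) ≤ cost(0) + cost(N).
      have hprev := hlt (N - 1) (by omega) (by omega)
      have hone := hc 1 le_rfl (by omega)
      have hz := Int.mul_ediv_add_emod (y - 0 * n) k
      have hz0 := Int.emod_nonneg (y - 0 * n) (show k ≠ 0 by omega)
      have h1 := Int.ediv_add_emod_le (k := k) (z := y - 1 * n)
        (p := (y - 0 * n) / k - Q - 1) (r := (y - 0 * n) % k + k - R)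
        (by omega) (by omega) (by linarith)
      have hp := Int.ediv_add_emod_le (k := k) (z := y - (N - 1) * n)
        (p := (y - N * n) / k + Q + 1) (r := (y - N * n) % k + R - k)
        (by omega) (by
          have e := Int.mul_ediv_add_emod (y - N * n) k
          have : -1 ≤ (y - N * n) / k := by
            rw [Int.le_ediv_iff_mul_le (by omega)]
            linarith
          have : (y - N * n) / k < 0 := Int.ediv_lt_of_lt_mul (by omega) (by omega)
          have : (y - N * n) / k = -1 := by omega
          rw [this] at e
          linarith) (by
          have e := Int.mul_ediv_add_emod (y - N * n) k
          linarith)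
      unfold coinCost at *
      linarith
  -- Pigeonhole on `1, …, N - 1`: counts with remainder above `o N` have distinct remainders, the
  -- others distinct costs strictly between `H` and cost(N). A collision would give `t - t'` a cost
  -- at most `H`.
  let S := Finset.Icc 1 (N - 1)
  let o : ℤ → ℤ := fun t => (y - t * n) % k
  have hno : ∀ t ∈ S, ∀ t' ∈ S, t' < t → ¬ coinCost k n y (t - t') ≤ coinCost k n y 0 := by
    intro t ht t' ht' hlt' hle
    rw [Finset.mem_Icc] at ht ht'
    linarith [hlt (t - t') (by omega) (by omega)]
  have hupper : (S.filter fun t => o N < o t).card ≤ (Finset.Ioo (o N) k).card := by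
    refine Finset.card_le_card_of_injOn o ?_ ?_
    · intro t ht
      have ht := (Finset.mem_filter.1 ht).2
      exact Finset.mem_coe.2 (Finset.mem_Ioo.2 ⟨ht, Int.emod_lt_of_pos _ (by omega)⟩)
    · intro t ht t' ht' he
      have ht := (Finset.mem_filter.1 ht).1
      have ht' := (Finset.mem_filter.1 ht').1
      rcases lt_trichotomy t t' with h | h | h
      · exact (hno _ ht' _ ht h
          (coinCost_sub_le_of_emod_eq (by omega) hkn h.le he.symm)).elim
      · exact h
      · exact (hno _ ht _ ht' h
          (coinCost_sub_le_of_emod_eq (by omega) hkn h.le he)).elim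
  have hlower : (S.filter fun t => ¬ o N < o t).card ≤
      (Finset.Ioo H (coinCost k n y N)).card := by
    refine Finset.card_le_card_of_injOn (coinCost k n y) ?_ ?_
    · intro t ht
      obtain ⟨ht, hto⟩ := Finset.mem_filter.1 ht
      rw [Finset.mem_Icc] at ht
      have e1 := coinCost_sub_le (k := k) (n := n) (y := y) (t := N) (t' := t) (by omega)
        (not_lt.1 hto)
      have e2 := hlt (N - t) (by omega) (by omega)
      exact Finset.mem_coe.2 (Finset.mem_Ioo.2 ⟨hlt t (by omega) (by omega), by linarith⟩)
    · intro t ht t' ht' he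
      have ht := (Finset.mem_filter.1 ht).1
      have ht' := (Finset.mem_filter.1 ht').1
      rcases lt_trichotomy t t' with h | h | h
      · exact (hno _ ht' _ ht h (coinCost_sub_le_of_eq hk hkn h.le he.symm)).elim
      · exact h
      · exact (hno _ ht _ ht' h (coinCost_sub_le_of_eq hk hkn h.le he)).elim
  have hcard := Finset.card_filter_add_card_filter_not (s := S) (fun t => o N < o t)
  simp only [S, Int.card_Icc, Int.card_Ioo] at hcard hupper hlower
  have hoN : o N = (y - N * n) % k := rfl
  have hval : coinCost k n y N = N + (y - N * n) / k + (y - N * n) % k := rfl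
  -- The count `N - 1 ≤ (k - 1 - o N) + (cost(N) - H - 1)` gives `H ≤ k - 1 + (y - N * n) / k ≤ Q +
  -- k - 2`, against `hH`.
  omega

/-! ### Representations, admissibility and the range -/

theorem HasRep.mono {a₂ a₃ h h' x : ℕ} (hh : h ≤ h') (hx : HasRep a₂ a₃ h x) :
    HasRep a₂ a₃ h' x := by
  obtain ⟨c₁, c₂, c₃, e, hc⟩ := hx
  exact ⟨c₁, c₂, c₃, e, hc.trans hh⟩

theorem HasRep.add_right {a₂ a₃ h x : ℕ} (hx : HasRep a₂ a₃ h x) :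
    HasRep a₂ a₃ (h + 1) (x + a₃) := by
  obtain ⟨c₁, c₂, c₃, e, hc⟩ := hx
  exact ⟨c₁, c₂, c₃ + 1, by rw [e]; ring, by omega⟩

theorem HasRep.le_mul {a₂ a₃ h x : ℕ} (h1a₂ : 1 < a₂) (ha₂a₃ : a₂ < a₃)
    (hx : HasRep a₂ a₃ h x) : x ≤ h * a₃ := by
  obtain ⟨c₁, c₂, c₃, e, hc⟩ := hx
  have := Nat.mul_le_mul_right a₃ hc
  have := Nat.mul_le_mul_left c₂ ha₂a₃.le
  nlinarith

section

variable {a₂ a₃ h : ℕ}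

theorem isLeast_not_hasRep (h1a₂ : 1 < a₂) (ha₂a₃ : a₂ < a₃) (h : ℕ) :
    IsLeast {x | ¬ HasRep a₂ a₃ h x} (hRange a₂ a₃ h + 1) := by
  have hne : {x | ¬ HasRep a₂ a₃ h x}.Nonempty :=
    ⟨h * a₃ + 1, fun hx => by have := hx.le_mul h1a₂ ha₂a₃; omega⟩
  have hmem := Nat.sInf_mem hne
  have hpos : sInf {x | ¬ HasRep a₂ a₃ h x} ≠ 0 := by
    intro h0
    rw [h0] at hmem
    exact hmem ⟨0, 0, 0, by simp, by simp⟩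
  have he : hRange a₂ a₃ h + 1 = sInf {x | ¬ HasRep a₂ a₃ h x} := by
    unfold hRange
    omega
  rw [he]
  exact ⟨hmem, fun _ hx => Nat.sInf_le hx⟩

theorem hasRep_of_le_hRange (h1a₂ : 1 < a₂) (ha₂a₃ : a₂ < a₃) {x : ℕ}
    (hx : x ≤ hRange a₂ a₃ h) : HasRep a₂ a₃ h x := by
  by_contra hn
  have := (isLeast_not_hasRep h1a₂ ha₂a₃ h).2 hn
  omega

theorem hRange_eq_of_isLeast (h1a₂ : 1 < a₂) (ha₂a₃ : a₂ < a₃) {m : ℕ}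
    (hm : IsLeast {x | ¬ HasRep a₂ a₃ h x} (m + 1)) : hRange a₂ a₃ h = m := by
  have := (isLeast_not_hasRep h1a₂ ha₂a₃ h).unique hm
  omega

theorem admissible_iff (h1a₂ : 1 < a₂) (ha₂a₃ : a₂ < a₃) :
    Admissible a₂ a₃ h ↔ ∀ x ≤ a₃, HasRep a₂ a₃ h x := by
  refine ⟨fun ha x hx => hasRep_of_le_hRange h1a₂ ha₂a₃ (hx.trans ha), fun hall => ?_⟩
  by_contra hn
  unfold Admissible at hn
  exact (isLeast_not_hasRep h1a₂ ha₂a₃ h).1 (hall _ (by omega))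

theorem Admissible.mono (h1a₂ : 1 < a₂) (ha₂a₃ : a₂ < a₃) {h' : ℕ} (hh : h ≤ h')
    (ha : Admissible a₂ a₃ h) : Admissible a₂ a₃ h' := by
  rw [admissible_iff h1a₂ ha₂a₃] at *
  exact fun x hx => (ha x hx).mono hh

/-- The number `(a₃ / a₂) * a₂ - 1` forces an admissible `h` to be large. -/
theorem Admissible.div_add_le (h1a₂ : 1 < a₂) (ha₂a₃ : a₂ < a₃) (ha : Admissible a₂ a₃ h) :
    a₃ / a₂ + a₂ ≤ h + 2 := by
  have hQ : 1 ≤ a₃ / a₂ := (Nat.one_le_div_iff (by omega)).2 ha₂a₃.le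
  have hle := Nat.div_mul_le_self a₃ a₂
  generalize a₃ / a₂ = Q at *
  have hpos : a₂ ≤ Q * a₂ := by nlinarith
  obtain ⟨c₁, c₂, c₃, e, hc⟩ := (admissible_iff h1a₂ ha₂a₃).1 ha (Q * a₂ - 1) (by omega)
  have hc3 : c₃ = 0 := by
    by_contra h3
    have := Nat.mul_le_mul_right a₃ (Nat.one_le_iff_ne_zero.2 h3)
    omega
  subst hc3
  have e' : Q * a₂ = c₂ * a₂ + c₁ + 1 := by omega
  obtain ⟨d, rfl⟩ : ∃ d, Q = c₂ + d := by
    refine ⟨Q - c₂, ?_⟩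
    have : c₂ ≤ Q := by
      by_contra! hlt
      nlinarith
    omega
  have hd : 1 ≤ d := by
    by_contra! hlt
    have : d = 0 := by omega
    subst this
    simp at e'
    omega
  have : c₁ + 1 = d * a₂ := by nlinarith
  nlinarith

/-- At an admissible level, translation by `a₃` creates no new representable numbers. -/
theorem HasRep.of_add_right (h1a₂ : 1 < a₂) (ha₂a₃ : a₂ < a₃) (ha : Admissible a₂ a₃ h) {x : ℕ}
    (hx : HasRep a₂ a₃ (h + 1) (x + a₃)) : HasRep a₂ a₃ h x := by
  obtain ⟨c₁, c₂, c₃, e, hc⟩ := hx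
  rcases c₃ with _ | c₃
  · have hz := Int.ediv_add_emod_le (k := a₂) (z := (x + a₃ : ℤ) - 0 * a₃) (p := c₂) (r := c₁)
      (by omega) (by omega) (by
        have : ((x + a₃ : ℕ) : ℤ) = ((0 * a₃ + c₂ * a₂ + c₁ : ℕ) : ℤ) := by rw [e]
        push_cast at this
        linarith)
    have hH := ha.div_add_le h1a₂ ha₂a₃
    obtain ⟨t, ht, hty, htc⟩ := exists_coinCost_le (k := a₂) (n := a₃) (y := x + a₃) (H := h + 1)
      (by omega) (by omega) (by omega)
      (by
        have : ((a₃ / a₂ + a₂ : ℕ) : ℤ) ≤ ((h + 2 : ℕ) : ℤ) := by exact_mod_cast hH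
        push_cast at this
        linarith)
      (by
        unfold coinCost
        omega)
    unfold coinCost at htc
    have hq : 0 ≤ ((x + a₃ : ℤ) - t * a₃) / a₂ := Int.ediv_nonneg (by omega) (by omega)
    have hr := Int.emod_nonneg ((x + a₃ : ℤ) - t * a₃) (show (a₂ : ℤ) ≠ 0 by omega)
    have hsum := Int.mul_ediv_add_emod ((x + a₃ : ℤ) - t * a₃) a₂
    generalize ((x + a₃ : ℤ) - t * a₃) / a₂ = q at *
    generalize ((x + a₃ : ℤ) - t * a₃) % a₂ = r at *
    obtain ⟨s, rfl⟩ : ∃ s : ℕ, t = s + 1 := ⟨(t - 1).toNat, by omega⟩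
    lift q to ℕ using hq
    lift r to ℕ using hr
    refine ⟨r, q, s, ?_, by omega⟩
    zify
    linarith
  · exact ⟨c₁, c₂, c₃, by nlinarith, by omega⟩

theorem Admissible.hasRep_add_iff (h1a₂ : 1 < a₂) (ha₂a₃ : a₂ < a₃) (ha : Admissible a₂ a₃ h)
    (x : ℕ) : HasRep a₂ a₃ (h + 1) (x + a₃) ↔ HasRep a₂ a₃ h x :=
  ⟨HasRep.of_add_right h1a₂ ha₂a₃ ha, HasRep.add_right⟩

theorem Admissible.hRange_succ (h1a₂ : 1 < a₂) (ha₂a₃ : a₂ < a₃) (ha : Admissible a₂ a₃ h) :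
    hRange a₂ a₃ (h + 1) = hRange a₂ a₃ h + a₃ := by
  have hl := isLeast_not_hasRep h1a₂ ha₂a₃ h
  refine hRange_eq_of_isLeast h1a₂ ha₂a₃ ⟨?_, fun x hx => ?_⟩
  · intro hr
    rw [add_right_comm, ha.hasRep_add_iff h1a₂ ha₂a₃] at hr
    exact hl.1 hr
  -- Admissibility leaves no gap below `a₃`, and any other gap would come from one at level `h`.
  · have hx : ¬ HasRep a₂ a₃ (h + 1) x := hx
    by_contra! hlt
    apply hx
    rcases lt_or_ge x a₃ with hxa | hxa
    · exact ((admissible_iff h1a₂ ha₂a₃).1 ha x hxa.le).mono (by omega)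
    · obtain ⟨z, rfl⟩ := Nat.exists_eq_add_of_le' hxa
      exact (hasRep_of_le_hRange h1a₂ ha₂a₃ (by omega)).add_right

theorem Admissible.gapsStable (h1a₂ : 1 < a₂) (ha₂a₃ : a₂ < a₃) (ha : Admissible a₂ a₃ h) :
    GapsStable a₂ a₃ h :=
  fun x _ _ => not_congr (ha.hasRep_add_iff h1a₂ ha₂a₃ x).symm

end

theorem exists_isLeast_nat {s : Set ℕ} {m : ℕ} (hm : m ∈ s) : ∃ k ≤ m, IsLeast s k :=
  ⟨sInf s, Nat.sInf_le hm, Nat.sInf_mem ⟨m, hm⟩, fun _ hx => Nat.sInf_le hx⟩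

theorem theorem4 (a₂ a₃ : ℕ) (h1a₂ : 1 < a₂) (ha₂a₃ : a₂ < a₃) :
    (∀ h : ℕ, Admissible a₂ a₃ h → ∀ x : ℕ, hRange a₂ a₃ h < x → x < h * a₃ →
      (¬ HasRep a₂ a₃ h x ↔ ¬ HasRep a₂ a₃ (h + 1) (x + a₃))) ∧
    (∃ h₀ h₂ : ℕ, IsH0 a₂ a₃ h₀ ∧ IsH2 a₂ a₃ h₂ ∧ h₂ ≤ h₀) := by
  refine ⟨fun h ha => ha.gapsStable h1a₂ ha₂a₃, ?_⟩
  have hadm : Admissible a₂ a₃ a₃ :=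
    (admissible_iff h1a₂ ha₂a₃).2 fun x hx => ⟨x, 0, 0, by simp, by simpa using hx⟩
  obtain ⟨h₀, -, hh₀⟩ := exists_isLeast_nat (s := {h | Admissible a₂ a₃ h}) hadm
  have hup : ∀ h, h₀ ≤ h → Admissible a₂ a₃ h := fun h hh => hh₀.1.mono h1a₂ ha₂a₃ hh
  obtain ⟨h₁, hle₁, hh₁⟩ := exists_isLeast_nat
    (s := {k : ℕ | ∀ h : ℕ, k ≤ h → hRange a₂ a₃ (h + 1) = hRange a₂ a₃ h + a₃}) (m := h₀)
    fun h hh => (hup h hh).hRange_succ h1a₂ ha₂a₃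
  obtain ⟨h₂, hle₂, hh₂⟩ := exists_isLeast_nat
    (s := {k : ℕ | h₁ ≤ k ∧ ∀ h : ℕ, k ≤ h → GapsStable a₂ a₃ h}) (m := h₀)
    ⟨hle₁, fun h hh => (hup h hh).gapsStable h1a₂ ha₂a₃⟩
  exact ⟨h₀, h₂, hh₀, ⟨h₁, hh₁, hh₂⟩, hle₂⟩
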